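/- Let $\mathbb{R}_3$ be the real Clifford algebra generated by $e_1,e_2,e_3$ with $e_j^2=-1$ and $e_ie_j=-e_je_i$ for $i\neq j$, and let $\lambda\mapsto\bar\lambda$ be its real-linear anti-automorphism with $\overline{e_j}=-e_j$. For an integer $k\ge 0$ let $\mathcal{M}(k)$ be the right $\mathbb{R}_3$-module of all $\mathbb{R}_3$-valued homogeneous polynomials $P$ of degree $k$ on $\mathbb{R}^3$ that are left monogenic, i.e. $\sum_{j=1}^3 e_j\,\partial_{x_j}P=0$. An orthonormal basis of $\mathcal{M}(k)$ is a finite family $Y^1,\dots,Y^d$ that spans $\mathcal{M}(k)$ over $\mathbb{R}_3$ and satisfies $\int_{S^2}\overline{Y^i(\omega)}\,Y^j(\omega)\,d\sigma(\omega)=\delta_{ij}$, where $\sigma$ is the surface measure of $S^2$ normalised to total mass one. The reproducing kernel of $\mathcal{M}(k)$ is $$K_k(x,y)=\sum_{l=1}^{d}Y^l(x)\,\overline{Y^l(y)},$$ and for $x,y\in S^2$ its closed form is $$(k+1)\,C_k^{1/2}(\langle x,y\rangle)+(x\wedge y)\,C_{k-1}^{3/2}(\langle x,y\rangle),\qquad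 x\wedge y=\sum_{i<j}e_ie_j\,(x_iy_j-x_jy_i),$$ where $\langle x,y\rangle=\sum_j x_jy_j$, $C_n^\mu$ are the Gegenbauer polynomials and $C_{-1}^{3/2}=0$. For $\eta=(\eta_1,\dots,\eta_{k+1})\in(S^2)^{k+1}$ let $G(\eta)$ be the $(k+1)\times(k+1)$ matrix over $\mathbb{R}_3$ with entries $G(\eta)_{ij}=K_k(\eta_i,\eta_j)$. **Theorem.** For every $k\ge 0$ and for almost every $\eta\in(S^2)^{k+1}$, with respect to the product of the surface measures, the matrix $G(\eta)$ is invertible. This holds for $K_k$ built from any orthonormal basis of $\mathcal{M}(k)$, and for $K_k$ given by the closed form. -/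

import Mathlib

open MeasureTheory

/-- Euclidean three-space. -/
abbrev E3 : Type := EuclideanSpace ℝ (Fin 3)

/-- The unit sphere of Euclidean three-space. -/
abbrev S2 : Type := Metric.sphere (0 : E3) 1

/-- The quadratic form `v ↦ -(v₀² + v₁² + v₂²)`. -/
noncomputable abbrev negSq : QuadraticForm ℝ (Fin 3 → ℝ) :=
  QuadraticMap.weightedSumSquares ℝ (fun _ : Fin 3 => (-1 : ℝ))

/-- The eight-dimensional real Clifford algebra with `e j ^ 2 = -1` and `e i * e j = -(e j * e i)`
for `i ≠ j`. Its `star` is the Hermitian (Clifford) conjugation: the real-linear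
anti-automorphism that sends `e j` to `-e j`. -/
abbrev Cl3 : Type := CliffordAlgebra negSq

/-- The generators of the Clifford algebra. -/
noncomputable def e (j : Fin 3) : Cl3 := CliffordAlgebra.ι negSq (Pi.single j 1)

theorem e_sq (j : Fin 3) : e j * e j = -1 := by
  simp [e, CliffordAlgebra.ι_sq_scalar, QuadraticMap.weightedSumSquares_apply,
    Pi.single_apply]

theorem e_anticomm {i j : Fin 3} (h : i ≠ j) : e i * e j = -(e j * e i) := by
  have := CliffordAlgebra.ι_mul_ι_add_swap (Q := negSq)
    (Pi.single i (1 : ℝ)) (Pi.single j 1)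
  rw [eq_neg_iff_add_eq_zero, e, e, this]
  have h0 : QuadraticMap.polar negSq (Pi.single i (1 : ℝ)) (Pi.single j 1) = 0 := by
    fin_cases i <;> fin_cases j <;>
      simp_all [QuadraticMap.polar, QuadraticMap.weightedSumSquares_apply, Fin.sum_univ_three,
        Pi.single_apply]
  rw [h0, map_zero]

theorem star_e (j : Fin 3) : star (e j) = -e j := by
  simp [e, CliffordAlgebra.star_def]

/-- Polynomials in three real variables with coefficients in the Clifford algebra: `P α` is the
coefficient of the monomial `x ^ α`. The Clifford algebra acts on them on both sides; the right
action is the action of `Cl3ᵐᵒᵖ`. -/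
abbrev CliffordPoly : Type := (Fin 3 →₀ ℕ) →₀ Cl3

namespace CliffordPoly

/-- The value of a Clifford polynomial at a point. -/
noncomputable def eval (x : E3) (P : CliffordPoly) : Cl3 :=
  P.sum fun α c => (α.prod fun i n => x i ^ n) • c

/-- The partial derivative in the `j`-th variable, `x ^ α c ↦ α_j x ^ (α - 1_j) c`. -/
noncomputable def pderiv (j : Fin 3) : CliffordPoly →ₗ[Cl3ᵐᵒᵖ] CliffordPoly :=
  Finsupp.lsum ℕ fun α => (α j) • Finsupp.lsingle (α - Finsupp.single j 1)

/-- The Dirac operator `∑ j, e j ∂_j`, acting from the left. -/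
noncomputable def dirac : CliffordPoly →ₗ[Cl3ᵐᵒᵖ] CliffordPoly :=
  ∑ j : Fin 3, e j • pderiv j

end CliffordPoly

/-- The right Clifford module of the left monogenic homogeneous polynomials of degree `k`
(the solid inner spherical monogenics of order `k`). -/
noncomputable def sphericalMonogenics (k : ℕ) : Submodule Cl3ᵐᵒᵖ CliffordPoly :=
  Finsupp.supported Cl3 Cl3ᵐᵒᵖ {α : Fin 3 →₀ ℕ | α.degree = k} ⊓ LinearMap.ker CliffordPoly.dirac

/-- The surface measure of the unit sphere. -/
noncomputable abbrev surfaceMeasure : Measure S2 := (volume : Measure E3).toSphere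

/-- `Y` is an orthonormal basis of the right Clifford module of spherical monogenics of order `k`:
it spans the module, and `∫ star (Y i) * Y j = δ i j`, with the integral over the sphere with
respect to the normalised surface measure. The integral of the Clifford-valued function is
expressed through all real-linear functionals on the (finite-dimensional) Clifford algebra. -/
structure IsMonogenicONB (k : ℕ) {d : ℕ} (Y : Fin d → CliffordPoly) : Prop where
  span_eq : Submodule.span Cl3ᵐᵒᵖ (Set.range Y) = sphericalMonogenics k
  orthonormal : ∀ (i j : Fin d) (φ : Cl3 →ₗ[ℝ] ℝ),
    ⨍ ω, φ (star ((Y i).eval (ω : E3)) * (Y j).eval (ω : E3)) ∂surfaceMeasure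
      = φ (if i = j then 1 else 0)

/-- The kernel `K(x, y) = ∑ l, Y l (x) * star (Y l (y))`; for an orthonormal basis `Y` of the
spherical monogenics of order `k` it is their reproducing kernel. -/
noncomputable def monogenicKernel {d : ℕ} (Y : Fin d → CliffordPoly) (x y : E3) : Cl3 :=
  ∑ l, (Y l).eval x * star ((Y l).eval y)

/-- The Gegenbauer polynomial `C_n^μ(t)`. -/
noncomputable def gegenbauer (μ : ℝ) (n : ℕ) (t : ℝ) : ℝ :=
  ∑ j ∈ Finset.range (n / 2 + 1),
    (-1) ^ j * (ascPochhammer ℝ (n - j)).eval μ / (j.factorial * (n - 2 * j).factorial)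
      * (2 * t) ^ (n - 2 * j)

/-- The bivector `x ∧ y = ∑_{i < j} e i e j (x i y j - x j y i)`. -/
noncomputable def wedge (x y : E3) : Cl3 :=
  ∑ i : Fin 3, ∑ j ∈ Finset.Ioi i, (x i * y j - x j * y i) • (e i * e j)

/-- The closed form `(k+1) C_k^{1/2}(⟨x,y⟩) + (x ∧ y) C_{k-1}^{3/2}(⟨x,y⟩)` of the reproducing kernel
for unit vectors `x`, `y`, where `C_{-1}^{3/2} = 0`. -/
noncomputable def closedFormKernel (k : ℕ) (x y : E3) : Cl3 :=
  algebraMap ℝ Cl3 ((k + 1) * gegenbauer (1 / 2) k (inner ℝ x y))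
    + (if k = 0 then 0 else gegenbauer (3 / 2) (k - 1) (inner ℝ x y)) • wedge x y

/-- The Gram matrix `G(η) i j = K(η i, η j)` of a Clifford-valued kernel. -/
noncomputable def gramMatrix {n : ℕ} (K : E3 → E3 → Cl3) (η : Fin n → S2) :
    Matrix (Fin n) (Fin n) Cl3 :=
  Matrix.of fun i j => K (η i : E3) (η j : E3)

/-! Both kernels extend to polynomial kernels on pairs of vectors, homogeneous of degree `k` in each
variable. The Gram matrix of a tuple of vectors lies in a finite-dimensional real algebra, so it is
invertible exactly when the determinant of its left multiplication is nonzero. That determinant is a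
real-analytic function of the tuple, so its zeros form a null set as soon as one tuple gives an
invertible matrix. Rescaling a vector does not affect invertibility, and the surface measure is an
image of Lebesgue measure on the ball, so the conclusion descends to the sphere
(`ae_isUnit_gramMatrix`).

The tuple used for both kernels is `(0, i, 1)`, `i = 0, …, k`. For a spanning family `Y`, the Gram
matrix is `V * Vᴴ` with `V` the matrix of values of `Y`. The monomials `x₁^b x₂^(k-b)` extend from
the plane `x₀ = 0` to monogenic polynomials, which are combinations of `Y`; their values form a
Vandermonde matrix, so `V` has a right inverse. The conjugation is positive definite because the
algebra embeds in two copies of the quaternions, hence `V * Vᴴ` is invertible.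

For the closed form, `e 1 * e 2` acts as an imaginary unit on that plane. The kernel becomes a
binary form `∑ c_a w^a w̄^(k-a)` with `c_a > 0`, where `w` is a factor depending on `i` times one
depending on `j`. So the Gram matrix is Vandermonde times diagonal times Vandermonde. The two
kernels never need to be compared. -/

/-! ### Zero sets of real-analytic functions -/

theorem AnalyticOnNhd.countable_zeros {g : ℝ → ℝ} (hg : AnalyticOnNhd ℝ g Set.univ) {t₀ : ℝ}
    (h₀ : g t₀ ≠ 0) : {t | g t = 0}.Countable := by
  have h := hg.preimage_zero_mem_codiscrete h₀
  rw [mem_codiscrete'] at h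
  have hd := h.2
  have hs : (g ⁻¹' {0}ᶜ)ᶜ = {t | g t = 0} := by ext; simp
  rw [hs] at hd
  have hd' : DiscreteTopology {t | g t = 0} := hd.to_subtype
  exact Set.countable_coe_iff.mp (countable_of_Lindelof_of_discrete (X := {t | g t = 0}))

/-- A real-analytic function that does not vanish identically is almost everywhere nonzero. -/
theorem AnalyticOnNhd.ae_ne_zero {V : Type*} [NormedAddCommGroup V] [NormedSpace ℝ V]
    [FiniteDimensional ℝ V] [MeasurableSpace V] [BorelSpace V] (μ : Measure V)
    [μ.IsAddHaarMeasure] {f : V → ℝ} (hf : AnalyticOnNhd ℝ f Set.univ) {x₀ : V}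
    (h₀ : f x₀ ≠ 0) : ∀ᵐ x ∂μ, f x ≠ 0 := by
  have hcont : Continuous f := by
    rw [← continuousOn_univ]; exact hf.continuousOn
  suffices H : ∀ᵐ x ∂μ, f (x₀ + x) ≠ 0 by
    have := (measurePreserving_add_left μ (-x₀)).quasiMeasurePreserving.ae H
    simpa using this
  have hsing : ∀ᵐ x ∂μ, x ∈ ({0}ᶜ : Set V) → f (x₀ + x) ≠ 0 := by
    have hms : MeasurableSet ({0}ᶜ : Set V) := (measurableSet_singleton 0).compl
    rw [← ae_restrict_iff' hms, ae_restrict_iff_subtype hms]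
    have hmp := Measure.measurePreserving_homeomorphUnitSphereProd μ
    have hprod : ∀ᵐ p ∂(μ.toSphere.prod (Measure.volumeIoiPow (Module.finrank ℝ V - 1))),
        f (x₀ + (p.2 : ℝ) • (p.1 : V)) ≠ 0 := by
      rw [Measure.ae_prod_iff_ae_ae]
      · refine Filter.Eventually.of_forall fun v => ?_
        have hline : AnalyticOnNhd ℝ (fun t : ℝ => f (x₀ + t • (v : V))) Set.univ := by
          intro t _
          exact AnalyticAt.fun_comp (hf _ trivial) (by fun_prop)
        -- In polar coordinates around `x₀`, every ray starts at `x₀`, where `f` is nonzero; so `f`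
        -- has only countably many zeros on each ray.
        have hcount := hline.countable_zeros (t₀ := 0) (by simpa using h₀)
        rw [Measure.volumeIoiPow]
        refine (withDensity_absolutelyContinuous _ _).ae_le ?_
        refine (ae_iff.mpr ?_)
        rw [comap_subtype_coe_apply measurableSet_Ioi]
        refine measure_mono_null ?_ (hcount.measure_zero volume)
        rintro _ ⟨t, ht, rfl⟩
        simpa using ht
      · exact (measurableSet_eq_fun (by fun_prop) measurable_const).compl
    have := hmp.quasiMeasurePreserving.ae hprod
    filter_upwards [this] with x hx
    have hx0 : ‖(x : V)‖ ≠ 0 := norm_ne_zero_iff.mpr x.2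
    simpa [smul_smul, hx0] using hx
  rcases subsingleton_or_nontrivial V with hV | hV
  · exact Filter.Eventually.of_forall fun x => by rwa [Subsingleton.elim (x₀ + x) x₀]
  · filter_upwards [hsing, Measure.ae_ne μ 0] with x hx hx0 using hx hx0

/-! ### The surface measure as an image of Lebesgue measure -/

/-- The point of the sphere in the direction of a vector. -/
noncomputable def sphereDirection (x : E3) : S2 :=
  if h : x ≠ 0 then (homeomorphUnitSphereProd E3 ⟨x, h⟩).1
  else ⟨EuclideanSpace.single 0 1, by simp⟩

theorem sphereDirection_coe {x : E3} (h : x ≠ 0) : (sphereDirection x : E3) = ‖x‖⁻¹ • x := by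
  simp [sphereDirection, h]

theorem measurable_sphereDirection : Measurable sphereDirection := by
  unfold sphereDirection
  exact Measurable.dite (s := {x : E3 | x ≠ 0})
    (f := fun x => (homeomorphUnitSphereProd E3 x).1)
    (measurable_fst.comp (homeomorphUnitSphereProd E3).measurable) measurable_const
    (measurableSet_singleton 0).compl

/-- `toSphere` measures a set by the dimension, here 3, times the volume of the cone over it in the
unit ball; that cone is, up to the origin, its preimage under `sphereDirection`. -/
theorem map_sphereDirection :
    ((3 : ℕ) • (volume : Measure E3).restrict (Metric.ball 0 1)).map sphereDirection
      = surfaceMeasure := by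
  ext s hs
  rw [Measure.map_apply measurable_sphereDirection hs, surfaceMeasure,
    Measure.toSphere_apply' _ hs, Measure.smul_apply,
    Measure.restrict_apply (measurable_sphereDirection hs)]
  simp only [finrank_euclideanSpace, Fintype.card_fin, nsmul_eq_mul]
  congr 1
  have h0 : ∀ᵐ x ∂(volume : Measure E3), x ≠ 0 := Measure.ae_ne _ 0
  refine measure_congr ?_
  filter_upwards [h0] with x hx
  have hn : 0 < ‖x‖ := norm_pos_iff.mpr hx
  refine propext ⟨?_, ?_⟩
  · rintro ⟨h1, h2⟩
    have h2' : ‖x‖ < 1 := by simpa using h2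
    refine Set.mem_smul.mpr ⟨‖x‖, ⟨hn, h2'⟩, _, ⟨_, h1, rfl⟩, ?_⟩
    rw [sphereDirection_coe hx, smul_smul, mul_inv_cancel₀ hn.ne', one_smul]
  · intro h
    obtain ⟨r, hr, _, ⟨v, hv, rfl⟩, rfl⟩ := Set.mem_smul.mp h
    have hv1 : ‖(v : E3)‖ = 1 := by simp
    have hnr : ‖r • (v : E3)‖ = r := by rw [norm_smul, hv1, mul_one, Real.norm_of_nonneg hr.1.le]
    refine ⟨?_, by simpa [hnr] using hr.2⟩
    have : sphereDirection (r • (v : E3)) = v := by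
      apply Subtype.ext
      rw [sphereDirection_coe hx, hnr, smul_smul, inv_mul_cancel₀ hr.1.ne', one_smul]
    simpa [Set.mem_preimage, this] using hv

/-- A property of the directions of almost every tuple of vectors holds for almost every tuple of
points of the sphere. -/
theorem ae_pi_surfaceMeasure {n : ℕ} {p : (Fin n → S2) → Prop} (hp : MeasurableSet {η | p η})
    (h : ∀ᵐ x : Fin n → E3, p fun i => sphereDirection (x i)) :
    ∀ᵐ η ∂(Measure.pi fun _ : Fin n => surfaceMeasure), p η := by
  have : IsFiniteMeasure ((volume : Measure E3).restrict (Metric.ball 0 1)) :=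
    ⟨by simp⟩
  have hac : Measure.pi (fun _ : Fin n =>
      (3 : ℕ) • (volume : Measure E3).restrict (Metric.ball 0 1)) ≪ volume := by
    have : Measure.pi (fun _ : Fin n =>
        (3 : ℕ) • (volume : Measure E3).restrict (Metric.ball 0 1)) =
        ((3 : ℕ) ^ n) • Measure.pi (fun _ : Fin n =>
          (volume : Measure E3).restrict (Metric.ball 0 1)) :=
      Measure.pi_eq fun s _ => by simp [Finset.prod_mul_distrib]
    rw [this, ← Measure.restrict_pi_pi]
    exact (Measure.restrict_le_self.absolutelyContinuous).smul_left _
  have hmap := Measure.pi_map_pi (μ := fun _ : Fin n =>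
      (3 : ℕ) • (volume : Measure E3).restrict (Metric.ball 0 1))
      (f := fun _ => sphereDirection)
      (hμ := fun _ => by rw [map_sphereDirection]; infer_instance)
      (fun _ => measurable_sphereDirection.aemeasurable)
  simp only [map_sphereDirection] at hmap
  rw [← hmap, ae_map_iff (by
    exact (measurable_pi_lambda _ fun i =>
      measurable_sphereDirection.comp (measurable_pi_apply i)).aemeasurable) hp]
  exact hac.ae_le h

/-! ### The Clifford algebra inside two copies of the quaternions -/

theorem ι_eq_sum (m : Fin 3 → ℝ) : CliffordAlgebra.ι negSq m = m 0 • e 0 + m 1 • e 1 + m 2 • e 2 := by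
  have : m = m 0 • Pi.single 0 1 + m 1 • Pi.single 1 1 + m 2 • Pi.single 2 1 := by
    ext i; fin_cases i <;> simp
  conv_lhs => rw [this]
  simp [e]

/-- The purely imaginary quaternion with imaginary parts `s * m i`. -/
noncomputable def imQuaternion (s : ℝ) (m : Fin 3 → ℝ) : Quaternion ℝ :=
  ⟨0, s * m 0, s * m 1, s * m 2⟩

@[simp] theorem re_imQuaternion (s : ℝ) (m : Fin 3 → ℝ) : (imQuaternion s m).re = 0 := rfl

@[simp] theorem imI_imQuaternion (s : ℝ) (m : Fin 3 → ℝ) : (imQuaternion s m).imI = s * m 0 := rfl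

@[simp] theorem imJ_imQuaternion (s : ℝ) (m : Fin 3 → ℝ) : (imQuaternion s m).imJ = s * m 1 := rfl

@[simp] theorem imK_imQuaternion (s : ℝ) (m : Fin 3 → ℝ) : (imQuaternion s m).imK = s * m 2 := rfl

/-- For `s = 1` and `s = -1`, the two representations of the Clifford algebra on the quaternions. -/
noncomputable def toQuaternion (s : ℝ) (hs : s * s = 1) : Cl3 →ₐ[ℝ] Quaternion ℝ :=
  CliffordAlgebra.lift negSq
    ⟨{ toFun := imQuaternion s
       map_add' := fun x y => by ext <;> simp [mul_add]
       map_smul' := fun r x => by ext <;> simp [mul_left_comm] }, fun m => by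
      have h : ∀ a b : ℝ, s * a * (s * b) = a * b := fun a b => by linear_combination a * b * hs
      ext <;> simp [QuadraticMap.weightedSumSquares_apply, Fin.sum_univ_three, h] <;> ring⟩

theorem toQuaternion_ι (s : ℝ) (hs : s * s = 1) (m : Fin 3 → ℝ) :
    toQuaternion s hs (CliffordAlgebra.ι negSq m) = imQuaternion s m := by
  rw [toQuaternion, CliffordAlgebra.lift_ι_apply]
  rfl

theorem toQuaternion_star (s : ℝ) (hs : s * s = 1) (a : Cl3) :
    toQuaternion s hs (star a) = star (toQuaternion s hs a) := by
  induction a using CliffordAlgebra.induction with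
  | algebraMap r => simp [CliffordAlgebra.star_algebraMap]
  | ι m =>
    rw [CliffordAlgebra.star_ι, map_neg, toQuaternion_ι]
    ext <;> simp
  | mul a b ha hb => rw [star_mul, map_mul, map_mul, star_mul, ha, hb]
  | add a b ha hb => rw [star_add, map_add, map_add, star_add, ha, hb]

/-- The two quaternionic representations together. -/
noncomputable def toQuaternionProd : Cl3 →ₐ[ℝ] Quaternion ℝ × Quaternion ℝ :=
  (toQuaternion 1 (by norm_num)).prod (toQuaternion (-1) (by norm_num))

/-- The inverse of `toQuaternionProd`. -/
noncomputable def ofQuaternionProd (z : Quaternion ℝ × Quaternion ℝ) : Cl3 :=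
  (1 / 2 : ℝ) • ((z.1.re + z.2.re) • 1 + (z.2.re - z.1.re) • (e 0 * (e 1 * e 2))
    + (z.1.imI - z.2.imI) • e 0 + (z.1.imI + z.2.imI) • (e 1 * e 2)
    + (z.1.imJ - z.2.imJ) • e 1 - (z.1.imJ + z.2.imJ) • (e 0 * e 2)
    + (z.1.imK - z.2.imK) • e 2 + (z.1.imK + z.2.imK) • (e 0 * e 1))

/-- Compatibility with left multiplication by vectors is the inductive step for the left-inverse
property. The rewrite rules sort every product into increasing order of the generators, after which
coefficients are compared. The two representations differ in the sign they give to `e 0 * (e 1 * e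
2)`. -/
theorem ofQuaternionProd_mul (m : Fin 3 → ℝ) (z : Quaternion ℝ × Quaternion ℝ) :
    ofQuaternionProd (toQuaternionProd (CliffordAlgebra.ι negSq m) * z)
      = CliffordAlgebra.ι negSq m * ofQuaternionProd z := by
  have h10 : e 1 * e 0 = -(e 0 * e 1) := e_anticomm (by decide)
  have h20 : e 2 * e 0 = -(e 0 * e 2) := e_anticomm (by decide)
  have h21 : e 2 * e 1 = -(e 1 * e 2) := e_anticomm (by decide)
  have g : ∀ (j : Fin 3) (x : Cl3), e j * (e j * x) = -x := fun j x => by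
    rw [← mul_assoc, e_sq, neg_one_mul]
  have g10 : ∀ x : Cl3, e 1 * (e 0 * x) = -(e 0 * (e 1 * x)) := fun x => by
    rw [← mul_assoc, h10, neg_mul, mul_assoc]
  have g20 : ∀ x : Cl3, e 2 * (e 0 * x) = -(e 0 * (e 2 * x)) := fun x => by
    rw [← mul_assoc, h20, neg_mul, mul_assoc]
  have g21 : ∀ x : Cl3, e 2 * (e 1 * x) = -(e 1 * (e 2 * x)) := fun x => by
    rw [← mul_assoc, h21, neg_mul, mul_assoc]
  have hp : toQuaternionProd (CliffordAlgebra.ι negSq m) =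
      (imQuaternion 1 m, imQuaternion (-1) m) :=
    Prod.ext (toQuaternion_ι _ _ _) (toQuaternion_ι _ _ _)
  rw [hp, ι_eq_sum]
  simp only [ofQuaternionProd, mul_add, add_mul, mul_sub, smul_mul_assoc, mul_smul_comm, e_sq, g,
    h10, h20, h21, g10, g20, g21, mul_one, mul_neg, neg_neg, Prod.fst_mul, Prod.snd_mul,
    Quaternion.re_mul, Quaternion.imI_mul, Quaternion.imJ_mul, Quaternion.imK_mul,
    re_imQuaternion, imI_imQuaternion, imJ_imQuaternion, imK_imQuaternion]
  match_scalars <;> ring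

theorem ofQuaternionProd_toQuaternionProd (a : Cl3) :
    ofQuaternionProd (toQuaternionProd a) = a := by
  induction a using CliffordAlgebra.left_induction with
  | algebraMap r =>
    rw [AlgHom.commutes, Algebra.algebraMap_eq_smul_one]
    simp [ofQuaternionProd, Algebra.algebraMap_eq_smul_one, ← two_mul, smul_smul, Quaternion.re_one,
      Quaternion.imI_one, Quaternion.imJ_one, Quaternion.imK_one]
  | add a b ha hb =>
    conv_rhs => rw [← ha, ← hb]
    simp only [ofQuaternionProd, map_add, Prod.fst_add, Prod.snd_add, Quaternion.re_add,
      Quaternion.imI_add, Quaternion.imJ_add, Quaternion.imK_add]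
    module
  | ι_mul a m ha => rw [map_mul, ofQuaternionProd_mul, ha]

theorem toQuaternionProd_injective : Function.Injective toQuaternionProd :=
  Function.LeftInverse.injective ofQuaternionProd_toQuaternionProd

instance : Module.Finite ℝ Cl3 :=
  Module.Finite.of_injective toQuaternionProd.toLinearMap toQuaternionProd_injective

/-- Both representations carry `star` to quaternionic conjugation, so the hypothesis becomes a
vanishing sum of squared norms in each of them. -/
theorem eq_zero_of_sum_mul_star_eq_zero {ι : Type*} [Fintype ι] {a : ι → Cl3}
    (h : ∑ i, a i * star (a i) = 0) (i : ι) : a i = 0 := by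
  have key : ∀ (s : ℝ) (hs : s * s = 1), toQuaternion s hs (a i) = 0 := by
    intro s hs
    have h1 := congrArg (toQuaternion s hs) h
    simp only [map_sum, map_mul, toQuaternion_star, Quaternion.self_mul_star, map_zero] at h1
    have h2 : ∑ j, Quaternion.normSq (toQuaternion s hs (a j)) = 0 := by
      apply Quaternion.coe_injective (R := ℝ)
      simpa only [← Quaternion.algebraMap_def, map_sum, map_zero] using h1
    rw [Finset.sum_eq_zero_iff_of_nonneg fun _ _ => Quaternion.normSq_nonneg] at h2
    exact Quaternion.normSq_eq_zero.mp (h2 i (Finset.mem_univ i))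
  apply toQuaternionProd_injective
  rw [map_zero]
  exact Prod.ext (key _ _) (key _ _)

/-- If `V` has a right inverse over the Clifford algebra then `V * Vᴴ` is invertible. -/
theorem isUnit_mul_conjTranspose {m n : Type*} [Fintype m] [Fintype n] [DecidableEq m]
    {V : Matrix m n Cl3} {W : Matrix n m Cl3} (h : V * W = 1) : IsUnit (V * V.conjTranspose) := by
  -- In an Artinian ring it is enough that `X * (V * Vᴴ) = 0` forces `X = 0`.
  have : IsArtinianRing (Matrix m m Cl3) := IsArtinianRing.of_finite ℝ _
  rw [IsArtinianRing.isUnit_iff_isRightRegular, isRightRegular_iff_left_eq_zero_of_mul]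
  intro X hX
  have h0 : X * V = 0 := by
    have h1 : (X * V) * (X * V).conjTranspose = 0 := by
      rw [Matrix.conjTranspose_mul, Matrix.mul_assoc, ← Matrix.mul_assoc V, ← Matrix.mul_assoc X,
        hX, Matrix.zero_mul]
    ext i j
    have h2 := congrFun (congrFun h1 i) i
    exact eq_zero_of_sum_mul_star_eq_zero (by simpa [Matrix.mul_apply] using h2) j
  rw [← Matrix.mul_one X, ← h, ← Matrix.mul_assoc, h0, Matrix.zero_mul]

/-! ### Reduction to a single tuple of vectors -/

theorem isUnit_iff_det_mulLeft_ne_zero {A : Type*} [Ring A] [Algebra ℝ A] [Module.Finite ℝ A]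
    (a : A) : IsUnit a ↔ LinearMap.det (LinearMap.mulLeft ℝ a) ≠ 0 := by
  rw [IsUnit.isUnit_iff_mulLeft_bijective, ← isUnit_iff_ne_zero, ← LinearMap.isUnit_iff_isUnit_det,
    Module.End.isUnit_iff]
  rfl

/-- No norm on `A` is assumed, so analyticity of `F` is tested on linear functionals. The matrix
entries of left multiplication by `F v` are such functionals of `F v`. -/
theorem analyticAt_det_mulLeft {A V : Type*} [Ring A] [Algebra ℝ A] [Module.Finite ℝ A]
    [NormedAddCommGroup V] [NormedSpace ℝ V] {F : V → A} {x : V}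
    (hF : ∀ φ : A →ₗ[ℝ] ℝ, AnalyticAt ℝ (fun v => φ (F v)) x) :
    AnalyticAt ℝ (fun v => LinearMap.det (LinearMap.mulLeft ℝ (F v))) x := by
  let b := Module.finBasis ℝ A
  have : ∀ v, LinearMap.det (LinearMap.mulLeft ℝ (F v)) = ∑ σ : Equiv.Perm _,
      ((Equiv.Perm.sign σ : ℤ) : ℝ) * ∏ i, b.repr (F v * b i) (σ i) := by
    intro v
    rw [← LinearMap.det_toMatrix b, Matrix.det_apply']
    simp [LinearMap.toMatrix_apply]
  simp only [this]
  refine Finset.analyticAt_fun_sum _ fun σ _ => analyticAt_const.mul ?_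
  refine Finset.analyticAt_fun_prod _ fun i _ => ?_
  exact hF ((b.coord (σ i)).comp (LinearMap.mulRight ℝ (b i)))

/-- The Gram matrix of a Clifford-valued kernel at a tuple of vectors. -/
noncomputable def vectorGram {n : ℕ} (K : E3 → E3 → Cl3) (x : Fin n → E3) :
    Matrix (Fin n) (Fin n) Cl3 :=
  Matrix.of fun i j => K (x i) (x j)

theorem analyticOnNhd_det_vectorGram {n : ℕ} {K : E3 → E3 → Cl3}
    (hK : ∀ φ : Cl3 →ₗ[ℝ] ℝ, AnalyticOnNhd ℝ (fun p : E3 × E3 => φ (K p.1 p.2)) Set.univ) :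
    AnalyticOnNhd ℝ (fun x : Fin n → E3 => LinearMap.det (LinearMap.mulLeft ℝ (vectorGram K x)))
      Set.univ := by
  intro x _
  refine analyticAt_det_mulLeft fun φ => ?_
  have : ∀ x : Fin n → E3, φ (vectorGram K x) = ∑ i, ∑ j,
      (φ ∘ₗ Matrix.singleLinearMap ℝ i j) (K (x i) (x j)) := by
    intro x
    conv_lhs => rw [Matrix.matrix_eq_sum_single (vectorGram K x)]
    simp [vectorGram]
  simp only [this]
  refine Finset.analyticAt_fun_sum _ fun i _ => Finset.analyticAt_fun_sum _ fun j _ => ?_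
  exact (hK (φ ∘ₗ Matrix.singleLinearMap ℝ i j) (x i, x j) trivial).fun_comp
    (f := fun x : Fin n → E3 => (x i, x j))
    (((ContinuousLinearMap.proj (R := ℝ) (φ := fun _ : Fin n => E3) i).prod
      (ContinuousLinearMap.proj (R := ℝ) (φ := fun _ : Fin n => E3) j)).analyticAt x)

/-- Rescaling multiplies the Gram matrix on both sides by the invertible real diagonal matrix with
entries `r i ^ k`. -/
theorem isUnit_vectorGram_smul {n k : ℕ} {K : E3 → E3 → Cl3}
    (hhom : ∀ (r s : ℝ) (x y : E3), K (r • x) (s • y) = (r * s) ^ k • K x y)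
    {x : Fin n → E3} {r : Fin n → ℝ} (hr : ∀ i, r i ≠ 0) (h : IsUnit (vectorGram K x)) :
    IsUnit (vectorGram K fun i => r i • x i) := by
  let D : Matrix (Fin n) (Fin n) ℝ := Matrix.diagonal fun i => r i ^ k
  have hD : IsUnit D := by
    rw [Matrix.isUnit_diagonal, Pi.isUnit_iff]
    exact fun i => (pow_ne_zero _ (hr i)).isUnit
  have hD' := hD.map (algebraMap ℝ Cl3).mapMatrix
  have : vectorGram K (fun i => r i • x i) =
      (algebraMap ℝ Cl3).mapMatrix D * vectorGram K x * (algebraMap ℝ Cl3).mapMatrix D := by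
    ext i j
    simp only [D, RingHom.mapMatrix_apply, Matrix.diagonal_map (map_zero (algebraMap ℝ Cl3)),
      Matrix.mul_diagonal, Matrix.diagonal_mul, vectorGram, Matrix.of_apply, hhom]
    rw [← Algebra.commutes, ← Algebra.smul_def, ← Algebra.smul_def, smul_smul, mul_pow, mul_comm]
  rw [this]
  exact (hD'.mul h).mul hD'

/-- For an analytic homogeneous kernel, one tuple of vectors with an invertible Gram matrix suffices
for the Gram matrix to be invertible at almost every tuple of points of the sphere. -/
theorem ae_isUnit_gramMatrix {n k : ℕ} {K : E3 → E3 → Cl3}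
    (hK : ∀ φ : Cl3 →ₗ[ℝ] ℝ, AnalyticOnNhd ℝ (fun p : E3 × E3 => φ (K p.1 p.2)) Set.univ)
    (hhom : ∀ (r s : ℝ) (x y : E3), K (r • x) (s • y) = (r * s) ^ k • K x y)
    {x₀ : Fin n → E3} (hx₀ : IsUnit (vectorGram K x₀)) :
    ∀ᵐ η ∂(Measure.pi fun _ : Fin n => surfaceMeasure), IsUnit (gramMatrix K η) := by
  have hF := analyticOnNhd_det_vectorGram (n := n) hK
  have hcont : Continuous
      (fun x : Fin n → E3 => LinearMap.det (LinearMap.mulLeft ℝ (vectorGram K x))) := by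
    rw [← continuousOn_univ]; exact hF.continuousOn
  apply ae_pi_surfaceMeasure
  · have : {η : Fin n → S2 | IsUnit (gramMatrix K η)} = {η : Fin n → S2 |
        LinearMap.det (LinearMap.mulLeft ℝ (vectorGram K fun i => (η i : E3))) ≠ 0} := by
      ext η
      exact isUnit_iff_det_mulLeft_ne_zero (vectorGram K fun i => (η i : E3))
    rw [this]
    exact (isOpen_ne_fun (hcont.comp (f := fun (η : Fin n → S2) i => (η i : E3)) (by fun_prop))
      continuous_const).measurableSet
  · rw [isUnit_iff_det_mulLeft_ne_zero] at hx₀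
    have hne : ∀ i : Fin n, ∀ᵐ x : Fin n → E3, x i ≠ 0 := by
      intro i
      exact (Measure.quasiMeasurePreserving_eval (fun _ : Fin n => (volume : Measure E3)) i).ae
        (Measure.ae_ne volume 0)
    filter_upwards [hF.ae_ne_zero volume hx₀, ae_all_iff.mpr hne] with x hx hx0
    rw [← isUnit_iff_det_mulLeft_ne_zero] at hx
    have := isUnit_vectorGram_smul hhom (r := fun i => ‖x i‖⁻¹)
      (fun i => inv_ne_zero (norm_ne_zero_iff.mpr (hx0 i))) hx
    simpa only [gramMatrix, vectorGram, sphereDirection_coe (hx0 _)] using this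

/-! ### Monogenic polynomials and the Cauchy–Kovalevskaya extension -/

namespace CliffordPoly

theorem pderiv_apply (j : Fin 3) (P : CliffordPoly) (β : Fin 3 →₀ ℕ) :
    pderiv j P β = (β j + 1) • P (β + Finsupp.single j 1) := by
  induction P using Finsupp.induction_linear with
  | zero => simp
  | add P Q hP hQ => rw [map_add, Finsupp.add_apply, hP, hQ, Finsupp.add_apply, smul_add]
  | single α c =>
    have h1 : pderiv j (Finsupp.single α c)
        = α j • Finsupp.single (α - Finsupp.single j 1) c := by
      simp [pderiv]
    rw [h1, Finsupp.smul_apply, Finsupp.single_apply, Finsupp.single_apply]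
    by_cases hα : α = β + Finsupp.single j 1
    · simp [hα]
    · rw [if_neg hα, smul_zero]
      -- If `α j = 0` the subtraction `α - single j 1` truncates, but the factor `α j` removes the
      -- term.
      rcases Nat.eq_zero_or_pos (α j) with h0 | h0
      · rw [h0, zero_smul]
      · rw [if_neg, smul_zero]
        rintro rfl
        exact hα (tsub_add_cancel_of_le (Finsupp.single_le_iff.mpr h0)).symm

theorem dirac_apply (P : CliffordPoly) (β : Fin 3 →₀ ℕ) :
    dirac P β = ∑ j, e j * ((β j + 1) • P (β + Finsupp.single j 1)) := by
  simp [dirac, LinearMap.sum_apply, Finsupp.finsetSum_apply, pderiv_apply]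

/-- Evaluation at a point as a right linear map. -/
noncomputable def evalₗ (x : E3) : CliffordPoly →ₗ[Cl3ᵐᵒᵖ] Cl3 :=
  Finsupp.lsum ℕ fun α => (α.prod fun i n => x i ^ n) • LinearMap.id

theorem evalₗ_apply (x : E3) (P : CliffordPoly) : evalₗ x P = eval x P := by
  rw [evalₗ, Finsupp.lsum_apply]
  rfl

theorem eval_eq_sum (x : E3) (P : CliffordPoly) :
    eval x P = ∑ α ∈ P.support, (∏ i, x i ^ α i) • P α := by
  rw [eval, Finsupp.sum]
  exact Finset.sum_congr rfl fun α _ => by rw [Finsupp.prod_fintype _ _ fun i => pow_zero _]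

theorem eval_smul_point {k : ℕ} {P : CliffordPoly}
    (hP : P ∈ Finsupp.supported Cl3 Cl3ᵐᵒᵖ {α : Fin 3 →₀ ℕ | α.degree = k}) (r : ℝ) (x : E3) :
    eval (r • x) P = r ^ k • eval x P := by
  rw [eval_eq_sum, eval_eq_sum, Finset.smul_sum]
  refine Finset.sum_congr rfl fun α hα => ?_
  have hdeg : α.degree = k := (Finsupp.mem_supported _ P).mp hP hα
  rw [smul_smul, ← hdeg, Finsupp.degree_eq_sum, ← Finset.prod_pow_eq_pow_sum,
    ← Finset.prod_mul_distrib]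
  simp [mul_pow]

end CliffordPoly

open CliffordPoly

/-- The coefficients of the Cauchy–Kovalevskaya extension off the plane `x 0 = 0` of the polynomial
with coefficients `g`. -/
noncomputable def ckCoeff (g : ℕ → ℕ → Cl3) : ℕ → ℕ → ℕ → Cl3
  | 0, b, c => g b c
  | a + 1, b, c => ((a : ℝ) + 1)⁻¹ • (e 0 * ((b + 1) • (e 1 * ckCoeff g a (b + 1) c)
      + (c + 1) • (e 2 * ckCoeff g a b (c + 1))))

theorem ckCoeff_eq_zero {g : ℕ → ℕ → Cl3} {k : ℕ} (hg : ∀ b c, b + c ≠ k → g b c = 0)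
    (a b c : ℕ) (h : a + b + c ≠ k) : ckCoeff g a b c = 0 := by
  induction a generalizing b c with
  | zero => exact hg b c (by omega)
  | succ a ih => simp [ckCoeff, ih (b + 1) c (by omega), ih b (c + 1) (by omega)]

/-- Since `e 0 * e 0 = -1`, the Dirac equation solved for the derivative in `x 0` reads `∂₀ f = e 0
(e 1 ∂₁ f + e 2 ∂₂ f)`; the recursion defining `ckCoeff` is this equation on coefficients. -/
theorem ckCoeff_rec (g : ℕ → ℕ → Cl3) (a b c : ℕ) :
    e 0 * ((a + 1) • ckCoeff g (a + 1) b c) + e 1 * ((b + 1) • ckCoeff g a (b + 1) c)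
      + e 2 * ((c + 1) • ckCoeff g a b (c + 1)) = 0 := by
  have ha : ((a : ℝ) + 1) ≠ 0 := by positivity
  have hs : (a + 1) • ckCoeff g (a + 1) b c = e 0 * ((b + 1) • (e 1 * ckCoeff g a (b + 1) c)
      + (c + 1) • (e 2 * ckCoeff g a b (c + 1))) := by
    rw [← Nat.cast_smul_eq_nsmul ℝ, ckCoeff, smul_smul, Nat.cast_add_one, mul_inv_cancel₀ ha,
      one_smul]
  rw [hs, ← mul_assoc, e_sq, mul_smul_comm, mul_smul_comm, neg_one_mul]
  abel

/-- The monogenic extension of the monomial `x 1 ^ b * x 2 ^ c`. -/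
noncomputable def ckMonomial (b c : ℕ) : CliffordPoly :=
  Finsupp.ofSupportFinite
    (fun α => ckCoeff (fun b' c' => if b' = b ∧ c' = c then 1 else 0) (α 0) (α 1) (α 2)) <| by
    refine (Finsupp.finite_of_degree_le (b + c)).subset fun α hα => ?_
    by_contra hd
    refine hα (ckCoeff_eq_zero (k := b + c) (fun b' c' h => if_neg (by omega)) _ _ _ fun h => ?_)
    exact hd (by simp [Finsupp.degree_eq_sum, Fin.sum_univ_three, h])

theorem ckMonomial_apply (b c : ℕ) (α : Fin 3 →₀ ℕ) : ckMonomial b c α =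
    ckCoeff (fun b' c' => if b' = b ∧ c' = c then 1 else 0) (α 0) (α 1) (α 2) := rfl

theorem ckMonomial_mem (b c : ℕ) : ckMonomial b c ∈ sphericalMonogenics (b + c) := by
  refine ⟨(Finsupp.mem_supported _ _).mpr fun α hα => ?_, ?_⟩
  · by_contra hd
    refine (Finsupp.mem_support_iff.mp hα) (ckCoeff_eq_zero (k := b + c)
      (fun b' c' h => if_neg (by omega)) _ _ _ fun h => ?_)
    exact hd (by simp [Finsupp.degree_eq_sum, Fin.sum_univ_three, h])
  · refine LinearMap.mem_ker.mpr ?_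
    ext β
    rw [dirac_apply, Fin.sum_univ_three]
    simpa [ckMonomial_apply] using ckCoeff_rec _ (β 0) (β 1) (β 2)

theorem eval_ckMonomial (b c : ℕ) {x : E3} (hx : x 0 = 0) :
    eval x (ckMonomial b c) = algebraMap ℝ Cl3 (x 1 ^ b * x 2 ^ c) := by
  let γ : Fin 3 →₀ ℕ := Finsupp.equivFunOnFinite.symm ![0, b, c]
  have h0 : γ 0 = 0 := rfl
  have h1 : γ 1 = b := rfl
  have h2 : γ 2 = c := rfl
  rw [eval_eq_sum, Finset.sum_eq_single γ]
  · rw [ckMonomial_apply, Fin.prod_univ_three, h0, h1, h2, ckCoeff,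
      Algebra.algebraMap_eq_smul_one]
    simp
  · intro α _ hα
    by_cases hα0 : α 0 = 0
    · rw [ckMonomial_apply, hα0, ckCoeff, if_neg, smul_zero]
      rintro ⟨hb, hc⟩
      apply hα
      ext i
      fin_cases i
      exacts [hα0, hb, hc]
    · rw [Fin.prod_univ_three, hx, zero_pow hα0]
      simp
  · intro h
    rw [Finsupp.notMem_support_iff.mp h, smul_zero]

/-- The points `(0, i, 1)`. -/
noncomputable def linePoint {n : ℕ} (i : Fin n) : E3 := !₂[0, (i : ℝ), 1]

/-- At `(0, i, 1)` the extension of `x₁^b x₂^(k-b)` takes the value `i^b`, a Vandermonde entry with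
distinct nodes. -/
theorem isUnit_vectorGram_monogenicKernel {k d : ℕ} {Y : Fin d → CliffordPoly}
    (hY : Submodule.span Cl3ᵐᵒᵖ (Set.range Y) = sphericalMonogenics k) :
    IsUnit (vectorGram (monogenicKernel Y) (linePoint : Fin (k + 1) → E3)) := by
  let V : Matrix (Fin (k + 1)) (Fin d) Cl3 := Matrix.of fun i l => eval (linePoint i) (Y l)
  let T : Matrix (Fin (k + 1)) (Fin (k + 1)) ℝ := Matrix.vandermonde fun i => ((i : ℕ) : ℝ)
  have hT : IsUnit T := by
    rw [Matrix.isUnit_iff_isUnit_det, isUnit_iff_ne_zero, Matrix.det_vandermonde_ne_zero_iff]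
    intro i j hij
    exact Fin.ext (Nat.cast_injective hij)
  obtain ⟨u, hu⟩ := hT.map (algebraMap ℝ Cl3).mapMatrix
  have hspan : ∀ b : Fin (k + 1), ∃ c : Fin d → Cl3ᵐᵒᵖ,
      ∑ l, c l • Y l = ckMonomial b (k - b) := by
    intro b
    rw [← Submodule.mem_span_range_iff_exists_fun, hY]
    have := ckMonomial_mem b (k - b)
    rwa [Nat.add_sub_cancel' (Nat.lt_succ_iff.mp b.2)] at this
  choose c hc using hspan
  -- The module scalars act from the right, so the coefficients form a right factor of `V`.
  have hVC : V * Matrix.of (fun l b => (c b l).unop) = (algebraMap ℝ Cl3).mapMatrix T := by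
    ext i b
    have h := congrArg (evalₗ (linePoint i)) (hc b)
    rw [map_sum] at h
    simp only [map_smul, evalₗ_apply] at h
    rw [eval_ckMonomial _ _ (by simp [linePoint])] at h
    simp only [Matrix.mul_apply, V, T, Matrix.of_apply, RingHom.mapMatrix_apply, Matrix.map_apply,
      Matrix.vandermonde_apply]
    simpa [linePoint, MulOpposite.smul_eq_mul_unop] using h
  have hVW : V * (Matrix.of (fun l b => (c b l).unop) * u⁻¹.val) = 1 := by
    rw [← Matrix.mul_assoc, hVC, ← hu, Units.mul_inv]
  have hV : vectorGram (monogenicKernel Y) (linePoint : Fin (k + 1) → E3) = V * V.conjTranspose := by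
    ext i j
    simp [vectorGram, monogenicKernel, V, Matrix.mul_apply]
  rw [hV]
  exact isUnit_mul_conjTranspose hVW

theorem analyticOnNhd_monogenicKernel {d : ℕ} (Y : Fin d → CliffordPoly) (φ : Cl3 →ₗ[ℝ] ℝ) :
    AnalyticOnNhd ℝ (fun p : E3 × E3 => φ (monogenicKernel Y p.1 p.2)) Set.univ := by
  intro p _
  have hcoord : ∀ (q : E3 × E3 →L[ℝ] E3) (i : Fin 3), AnalyticAt ℝ (fun p => q p i) p :=
    fun q i => ((EuclideanSpace.proj (𝕜 := ℝ) i).comp q).analyticAt p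
  have h1 := hcoord (ContinuousLinearMap.fst ℝ E3 E3)
  have h2 := hcoord (ContinuousLinearMap.snd ℝ E3 E3)
  simp only [monogenicKernel, eval_eq_sum, star_sum, CliffordAlgebra.star_smul, Finset.sum_mul_sum,
    smul_mul_smul_comm, map_sum, map_smul, smul_eq_mul]
  refine Finset.analyticAt_fun_sum _ fun l _ => Finset.analyticAt_fun_sum _ fun α _ =>
    Finset.analyticAt_fun_sum _ fun β _ => AnalyticAt.mul (AnalyticAt.mul ?_ ?_) analyticAt_const
  · exact Finset.analyticAt_fun_prod _ fun i _ => (h1 i).pow _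
  · exact Finset.analyticAt_fun_prod _ fun i _ => (h2 i).pow _

theorem monogenicKernel_smul {k d : ℕ} {Y : Fin d → CliffordPoly}
    (hY : ∀ l, Y l ∈ sphericalMonogenics k) (r s : ℝ) (x y : E3) :
    monogenicKernel Y (r • x) (s • y) = (r * s) ^ k • monogenicKernel Y x y := by
  rw [monogenicKernel, monogenicKernel, Finset.smul_sum]
  refine Finset.sum_congr rfl fun l _ => ?_
  rw [eval_smul_point (hY l).1, eval_smul_point (hY l).1, CliffordAlgebra.star_smul,
    smul_mul_smul_comm, mul_pow]

/-! ### Homogenised Gegenbauer polynomials -/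

/-- The coefficient of `S ^ (n - 2 * j) * N ^ j` in the homogenised Gegenbauer polynomial. -/
noncomputable def gegenbauerCoeff (μ : ℝ) (n j : ℕ) : ℝ :=
  (-1) ^ j * (ascPochhammer ℝ (n - j)).eval μ / (j.factorial * (n - 2 * j).factorial)

/-- The homogenised Gegenbauer polynomial: `C_n^μ(t)` is its value at `S = 2 * t`, `N = 1`. -/
noncomputable def homGegenbauer (μ : ℝ) (n : ℕ) (S N : ℝ) : ℝ :=
  ∑ j ∈ Finset.range (n / 2 + 1), gegenbauerCoeff μ n j * S ^ (n - 2 * j) * N ^ j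

theorem homGegenbauer_one (μ : ℝ) (n : ℕ) (t : ℝ) :
    homGegenbauer μ n (2 * t) 1 = gegenbauer μ n t := by
  simp [homGegenbauer, gegenbauer, gegenbauerCoeff]

theorem homGegenbauer_smul (μ : ℝ) (n : ℕ) (c S N : ℝ) :
    homGegenbauer μ n (c * S) (c ^ 2 * N) = c ^ n * homGegenbauer μ n S N := by
  rw [homGegenbauer, homGegenbauer, Finset.mul_sum]
  refine Finset.sum_congr rfl fun j hj => ?_
  have h : n = (n - 2 * j) + 2 * j := by have := Finset.mem_range.mp hj; omega
  conv_rhs => rw [h, pow_add, pow_mul, ← h]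
  ring

/-- This puts polynomials of different degrees on a common range of summation. The condition `2 * j
≤ n` excludes the terms where `n - 2 * j` would truncate. -/
theorem homGegenbauer_eq_sum (μ : ℝ) (S N : ℝ) {n M : ℕ} (hM : n / 2 + 1 ≤ M) :
    homGegenbauer μ n S N = ∑ j ∈ Finset.range M,
      (if 2 * j ≤ n then gegenbauerCoeff μ n j else 0) * S ^ (n - 2 * j) * N ^ j := by
  rw [homGegenbauer, ← Finset.sum_subset (Finset.range_mono hM)]
  · refine Finset.sum_congr rfl fun j hj => ?_
    rw [if_pos]
    have := Finset.mem_range.mp hj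
    omega
  · intro j _ hj
    rw [if_neg, zero_mul, zero_mul]
    rw [Finset.mem_range] at hj
    omega

/-- Coefficient of `S^(r+1) N^(j+1)` in the three-term recurrence with `n = 2j + r + 1`. The next
two lemmas treat `n = 2j`, where the middle term is absent, and the coefficient of `N^0`. -/
theorem gegenbauerCoeff_rec (μ : ℝ) (j r : ℕ) :
    (2 * j + r + 3 : ℝ) * gegenbauerCoeff μ (2 * j + r + 3) (j + 1)
      = (2 * j + r + 2 + μ) * gegenbauerCoeff μ (2 * j + r + 2) (j + 1)
        - (2 * j + r + 1 + 2 * μ) * gegenbauerCoeff μ (2 * j + r + 1) j := by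
  have e1 : 2 * j + r + 3 - (j + 1) = j + r + 1 + 1 := by omega
  have e2 : 2 * j + r + 3 - 2 * (j + 1) = r + 1 := by omega
  have e3 : 2 * j + r + 2 - (j + 1) = j + r + 1 := by omega
  have e4 : 2 * j + r + 2 - 2 * (j + 1) = r := by omega
  have e5 : 2 * j + r + 1 - j = j + r + 1 := by omega
  have e6 : 2 * j + r + 1 - 2 * j = r + 1 := by omega
  simp only [gegenbauerCoeff, e1, e2, e3, e4, e5, e6]
  rw [ascPochhammer_succ_eval (j + r + 1), Nat.factorial_succ j, Nat.factorial_succ r]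
  have hj : (j.factorial : ℝ) ≠ 0 := by positivity
  have hr : (r.factorial : ℝ) ≠ 0 := by positivity
  have hj1 : (j : ℝ) + 1 ≠ 0 := by positivity
  have hr1 : (r : ℝ) + 1 ≠ 0 := by positivity
  push_cast
  field_simp
  ring

theorem gegenbauerCoeff_rec_even (μ : ℝ) (j : ℕ) :
    (2 * j + 2 : ℝ) * gegenbauerCoeff μ (2 * j + 2) (j + 1)
      = - ((2 * j + 2 * μ) * gegenbauerCoeff μ (2 * j) j) := by
  have e1 : 2 * j + 2 - (j + 1) = j + 1 := by omega
  have e2 : 2 * j + 2 - 2 * (j + 1) = 0 := by omega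
  have e5 : 2 * j - j = j := by omega
  have e6 : 2 * j - 2 * j = 0 := by omega
  simp only [gegenbauerCoeff, e1, e2, e5, e6]
  rw [ascPochhammer_succ_eval j, Nat.factorial_succ j]
  have hj : (j.factorial : ℝ) ≠ 0 := by positivity
  have hj1 : (j : ℝ) + 1 ≠ 0 := by positivity
  push_cast
  field_simp
  ring

theorem gegenbauerCoeff_rec_zero (μ : ℝ) (n : ℕ) :
    (n + 2 : ℝ) * gegenbauerCoeff μ (n + 2) 0 = (n + 1 + μ) * gegenbauerCoeff μ (n + 1) 0 := by
  simp only [gegenbauerCoeff, Nat.sub_zero, mul_zero]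
  rw [ascPochhammer_succ_eval (n + 1), Nat.factorial_succ (n + 1)]
  have hj : ((n + 1).factorial : ℝ) ≠ 0 := by positivity
  have hj1 : (n : ℝ) + 1 + 1 ≠ 0 := by positivity
  push_cast
  field_simp
  ring

/-- The three-term recurrence of the Gegenbauer polynomials. -/
theorem homGegenbauer_rec (μ : ℝ) (n : ℕ) (S N : ℝ) :
    (n + 2 : ℝ) * homGegenbauer μ (n + 2) S N = (n + 1 + μ) * (S * homGegenbauer μ (n + 1) S N)
      - (n + 2 * μ) * (N * homGegenbauer μ n S N) := by
  rw [homGegenbauer_eq_sum μ S N (n := n) (M := n + 1) (by omega),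
    homGegenbauer_eq_sum μ S N (n := n + 1) (M := n + 1 + 1) (by omega),
    homGegenbauer_eq_sum μ S N (n := n + 2) (M := n + 1 + 1) (by omega),
    Finset.sum_range_succ', Finset.sum_range_succ' _ (n + 1)]
  have h0 := gegenbauerCoeff_rec_zero μ n
  have hsum : (n + 2 : ℝ) * ∑ j ∈ Finset.range (n + 1),
        (if 2 * (j + 1) ≤ n + 2 then gegenbauerCoeff μ (n + 2) (j + 1) else 0)
          * S ^ (n + 2 - 2 * (j + 1)) * N ^ (j + 1)
      = (n + 1 + μ) * (S * ∑ j ∈ Finset.range (n + 1),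
          (if 2 * (j + 1) ≤ n + 1 then gegenbauerCoeff μ (n + 1) (j + 1) else 0)
            * S ^ (n + 1 - 2 * (j + 1)) * N ^ (j + 1))
        - (n + 2 * μ) * (N * ∑ j ∈ Finset.range (n + 1),
          (if 2 * j ≤ n then gegenbauerCoeff μ n j else 0) * S ^ (n - 2 * j) * N ^ j) := by
    simp only [Finset.mul_sum]
    rw [← Finset.sum_sub_distrib]
    refine Finset.sum_congr rfl fun j _ => ?_
    rcases lt_trichotomy (2 * j) n with h | h | h
    · obtain ⟨r, rfl⟩ : ∃ r, n = 2 * j + r + 1 := ⟨n - 2 * j - 1, by omega⟩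
      rw [if_pos (by omega), if_pos (by omega), if_pos (by omega),
        show 2 * j + r + 1 + 2 - 2 * (j + 1) = r + 1 by omega,
        show 2 * j + r + 1 + 1 - 2 * (j + 1) = r by omega,
        show 2 * j + r + 1 - 2 * j = r + 1 by omega]
      have := gegenbauerCoeff_rec μ j r
      push_cast
      linear_combination S ^ (r + 1) * N ^ (j + 1) * this
    · subst h
      rw [if_pos (by omega), if_neg (by omega), if_pos (by omega),
        show 2 * j + 2 - 2 * (j + 1) = 0 by omega, show 2 * j - 2 * j = 0 by omega]
      have := gegenbauerCoeff_rec_even μ j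
      push_cast
      linear_combination N ^ (j + 1) * this
    · rw [if_neg (by omega), if_neg (by omega), if_neg (by omega)]
      ring
  simp only [mul_zero, zero_le, if_true, Nat.sub_zero, pow_zero, mul_one]
  linear_combination hsum + S ^ (n + 2) * h0

theorem homGegenbauer_zero (μ S N : ℝ) : homGegenbauer μ 0 S N = 1 := by
  simp [homGegenbauer, gegenbauerCoeff]

theorem homGegenbauer_at_one (μ S N : ℝ) : homGegenbauer μ 1 S N = μ * S := by
  simp [homGegenbauer, gegenbauerCoeff]

/-! ### Gegenbauer polynomials as binary forms -/

/-- The binary form of degree `n` with coefficients `f`. -/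
noncomputable def binaryForm (f : ℕ → ℕ → ℝ) (w v : ℂ) (n : ℕ) : ℂ :=
  ∑ p ∈ Finset.HasAntidiagonal.antidiagonal n, (f p.1 p.2 : ℂ) * w ^ p.1 * v ^ p.2

/-- Comparison of coefficients: `h` handles `w^(i+1) v^(m+1)`, while `h0` and `h1` handle the pure
powers of `v` and `w`. -/
theorem binaryForm_rec {f : ℕ → ℕ → ℝ} {n : ℕ} {α β γ : ℝ} (w v : ℂ)
    (h : ∀ i m, i + m = n →
      α * f (i + 1) (m + 1) = β * (f i (m + 1) + f (i + 1) m) - γ * f i m)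
    (h0 : α * f 0 (n + 2) = β * f 0 (n + 1)) (h1 : α * f (n + 2) 0 = β * f (n + 1) 0) :
    α * binaryForm f w v (n + 2) = β * ((w + v) * binaryForm f w v (n + 1))
      - γ * (w * v * binaryForm f w v n) := by
  have hw : w * binaryForm f w v (n + 1) = f (n + 1) 0 * w ^ (n + 2)
      + ∑ p ∈ Finset.HasAntidiagonal.antidiagonal n, (f p.1 (p.2 + 1) : ℂ) * w ^ (p.1 + 1) * v ^ (p.2 + 1) := by
    rw [binaryForm, Finset.Nat.antidiagonal_succ', Finset.sum_cons, Finset.sum_map, mul_add,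
      Finset.mul_sum]
    congr 1
    · simp; ring
    · exact Finset.sum_congr rfl fun p _ => by simp; ring
  have hv : v * binaryForm f w v (n + 1) = f 0 (n + 1) * v ^ (n + 2)
      + ∑ p ∈ Finset.HasAntidiagonal.antidiagonal n, (f (p.1 + 1) p.2 : ℂ) * w ^ (p.1 + 1) * v ^ (p.2 + 1) := by
    rw [binaryForm, Finset.Nat.antidiagonal_succ, Finset.sum_cons, Finset.sum_map, mul_add,
      Finset.mul_sum]
    congr 1
    · simp; ring
    · exact Finset.sum_congr rfl fun p _ => by simp; ring
  have h2 : binaryForm f w v (n + 2) = f 0 (n + 2) * v ^ (n + 2) + (f (n + 2) 0 * w ^ (n + 2)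
      + ∑ p ∈ Finset.HasAntidiagonal.antidiagonal n,
        (f (p.1 + 1) (p.2 + 1) : ℂ) * w ^ (p.1 + 1) * v ^ (p.2 + 1)) := by
    rw [binaryForm, Finset.Nat.antidiagonal_succ_succ', Finset.sum_cons, Finset.sum_cons,
      Finset.sum_map]
    simp
  have h3 : (α : ℂ) * ∑ p ∈ Finset.HasAntidiagonal.antidiagonal n,
        (f (p.1 + 1) (p.2 + 1) : ℂ) * w ^ (p.1 + 1) * v ^ (p.2 + 1)
      = β * (∑ p ∈ Finset.HasAntidiagonal.antidiagonal n, (f p.1 (p.2 + 1) : ℂ) * w ^ (p.1 + 1) * v ^ (p.2 + 1))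
        + β * (∑ p ∈ Finset.HasAntidiagonal.antidiagonal n, (f (p.1 + 1) p.2 : ℂ) * w ^ (p.1 + 1) * v ^ (p.2 + 1))
        - γ * (w * v * binaryForm f w v n) := by
    simp only [binaryForm, Finset.mul_sum]
    rw [← Finset.sum_add_distrib, ← Finset.sum_sub_distrib]
    refine Finset.sum_congr rfl fun p hp => ?_
    have := congrArg (fun x : ℝ => (x : ℂ)) (h p.1 p.2 (Finset.HasAntidiagonal.mem_antidiagonal.mp hp))
    push_cast at this
    linear_combination w ^ (p.1 + 1) * v ^ (p.2 + 1) * this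
  have h0' := congrArg (fun x : ℝ => (x : ℂ)) h0
  have h1' := congrArg (fun x : ℝ => (x : ℂ)) h1
  push_cast at h0' h1'
  rw [add_mul, hw, hv, h2]
  linear_combination h3 + v ^ (n + 2) * h0' + w ^ (n + 2) * h1'

/-- The binomial coefficients `(μ)_m / m!` of `(1 - t) ^ (-μ)`. -/
noncomputable def pochhammerCoeff (μ : ℝ) (m : ℕ) : ℝ := (ascPochhammer ℝ m).eval μ / m.factorial

theorem pochhammerCoeff_zero (μ : ℝ) : pochhammerCoeff μ 0 = 1 := by simp [pochhammerCoeff]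

theorem pochhammerCoeff_succ (μ : ℝ) (m : ℕ) :
    pochhammerCoeff μ (m + 1) = pochhammerCoeff μ m * (μ + m) / (m + 1) := by
  rw [pochhammerCoeff, pochhammerCoeff, ascPochhammer_succ_eval, Nat.factorial_succ]
  have hj : (m.factorial : ℝ) ≠ 0 := by positivity
  have hj1 : (m : ℝ) + 1 ≠ 0 := by positivity
  push_cast
  field_simp

theorem pochhammerCoeff_pos {μ : ℝ} (hμ : 0 < μ) (m : ℕ) : 0 < pochhammerCoeff μ m :=
  div_pos (ascPochhammer_pos m μ hμ) (by positivity)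

/-- `C_n^μ` as a binary form in `w = exp (iθ)` and its conjugate. -/
theorem homGegenbauer_eq_binaryForm (μ : ℝ) (w : ℂ) (n : ℕ) :
    (homGegenbauer μ n (2 * w.re) (Complex.normSq w) : ℂ)
      = binaryForm (fun i m => pochhammerCoeff μ i * pochhammerCoeff μ m) w
        ((starRingEnd ℂ) w) n := by
  induction n using Nat.twoStepInduction with
  | zero => simp [homGegenbauer_zero, binaryForm, pochhammerCoeff_zero]
  | one =>
    rw [homGegenbauer_at_one]
    simp only [binaryForm, Finset.Nat.antidiagonal_succ, Finset.Nat.antidiagonal_zero]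
    push_cast
    simp [pochhammerCoeff_zero, pochhammerCoeff_succ]
    have := Complex.add_conj w
    push_cast at this
    linear_combination -(μ : ℂ) * this
  | more n ih0 ih1 =>
    -- With `2 Re w = w + w̄` and `|w|² = w w̄`, both sides satisfy the same three-term recurrence.
    have hr := congrArg (fun x : ℝ => (x : ℂ))
      (homGegenbauer_rec μ n (2 * w.re) (Complex.normSq w))
    have hb := binaryForm_rec (f := fun i m => pochhammerCoeff μ i * pochhammerCoeff μ m)
      (n := n) (α := n + 2) (β := n + 1 + μ) (γ := n + 2 * μ) w ((starRingEnd ℂ) w)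
      (by
        rintro i m rfl
        have hi : (i : ℝ) + 1 ≠ 0 := by positivity
        have hm : (m : ℝ) + 1 ≠ 0 := by positivity
        simp only [pochhammerCoeff_succ]
        push_cast
        field_simp
        ring)
      (by
        have hn : (n : ℝ) + 2 ≠ 0 := by positivity
        rw [pochhammerCoeff_succ μ (n + 1)]
        push_cast
        rw [show (n : ℝ) + 1 + 1 = n + 2 by ring]
        field_simp
        ring)
      (by
        have hn : (n : ℝ) + 2 ≠ 0 := by positivity
        rw [pochhammerCoeff_succ μ (n + 1)]
        push_cast
        rw [show (n : ℝ) + 1 + 1 = n + 2 by ring]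
        field_simp
        ring)
    have hn : (n : ℂ) + 2 ≠ 0 := by exact_mod_cast (by omega : n + 2 ≠ 0)
    apply mul_left_cancel₀ hn
    push_cast at hr hb
    rw [hr, hb, ← ih0, ← ih1, Complex.add_conj, Complex.mul_conj]
    push_cast
    ring

/-- `sin θ * C_n^{3/2} (cos θ)` as a binary form in `w = exp (iθ)` and its conjugate. -/
theorem sub_conj_mul_homGegenbauer (w : ℂ) (n : ℕ) :
    (w - (starRingEnd ℂ) w) / 2 * homGegenbauer (3 / 2) n (2 * w.re) (Complex.normSq w)
      = binaryForm (fun i m => ((i : ℝ) - m) * (pochhammerCoeff (1 / 2) i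
        * pochhammerCoeff (1 / 2) m)) w ((starRingEnd ℂ) w) (n + 1) := by
  -- The weight `i - m` is the effect of `w ∂_w - w̄ ∂_w̄` on the form of `C_{n+1}^{1/2}`: this
  -- operator kills `w w̄`, and the derivative of `C_{n+1}^{1/2}` is `C_n^{3/2}`. The identity
  -- itself is checked by the recurrence.
  induction n using Nat.twoStepInduction with
  | zero =>
    simp [homGegenbauer_zero, binaryForm, Finset.Nat.antidiagonal_succ, pochhammerCoeff_zero,
      pochhammerCoeff_succ]
    ring
  | one =>
    rw [homGegenbauer_at_one]
    push_cast
    simp [binaryForm, Finset.Nat.antidiagonal_succ, pochhammerCoeff_zero, pochhammerCoeff_succ]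
    have := Complex.add_conj w
    push_cast at this
    rw [← this]
    ring
  | more n ih0 ih1 =>
    have hr := congrArg (fun x : ℝ => (x : ℂ))
      (homGegenbauer_rec (3 / 2) n (2 * w.re) (Complex.normSq w))
    have hb := binaryForm_rec (f := fun i m => ((i : ℝ) - m) * (pochhammerCoeff (1 / 2) i
        * pochhammerCoeff (1 / 2) m))
      (n := n + 1) (α := n + 2) (β := n + 1 + 3 / 2) (γ := n + 2 * (3 / 2)) w ((starRingEnd ℂ) w)
      (by
        intro i m him
        have hn : (n : ℝ) = i + m - 1 := by
          rw [eq_sub_iff_add_eq]; exact_mod_cast him.symm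
        have hi : (i : ℝ) + 1 ≠ 0 := by positivity
        have hm : (m : ℝ) + 1 ≠ 0 := by positivity
        simp only [pochhammerCoeff_succ, hn]
        push_cast
        field_simp
        ring)
      (by
        have hn : (n : ℝ) + 3 ≠ 0 := by positivity
        rw [pochhammerCoeff_succ (1 / 2) (n + 1 + 1)]
        push_cast
        rw [show (n : ℝ) + 1 + 1 + 1 = n + 3 by ring]
        field_simp
        ring)
      (by
        have hn : (n : ℝ) + 3 ≠ 0 := by positivity
        rw [pochhammerCoeff_succ (1 / 2) (n + 1 + 1)]
        push_cast
        rw [show (n : ℝ) + 1 + 1 + 1 = n + 3 by ring]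
        field_simp
        ring)
    have hn : (n : ℂ) + 2 ≠ 0 := by exact_mod_cast (by omega : n + 2 ≠ 0)
    apply mul_left_cancel₀ hn
    push_cast at hr hb
    rw [mul_left_comm, hr, hb, ← ih0, ← ih1, Complex.add_conj, Complex.mul_conj]
    push_cast
    ring

/-! ### The closed-form kernel and its Gram matrix -/

/-- The closed form of the reproducing kernel, homogenised. -/
noncomputable def homKernel (k : ℕ) (x y : E3) : Cl3 :=
  algebraMap ℝ Cl3
      ((k + 1) * homGegenbauer (1 / 2) k (2 * inner ℝ x y) (inner ℝ x x * inner ℝ y y))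
    + (if k = 0 then 0 else
        homGegenbauer (3 / 2) (k - 1) (2 * inner ℝ x y) (inner ℝ x x * inner ℝ y y)) • wedge x y

theorem wedge_eq (x y : E3) : wedge x y = (x 0 * y 1 - x 1 * y 0) • (e 0 * e 1)
    + (x 0 * y 2 - x 2 * y 0) • (e 0 * e 2) + (x 1 * y 2 - x 2 * y 1) • (e 1 * e 2) := by
  have h0 : Finset.Ioi (0 : Fin 3) = {1, 2} := by decide
  have h1 : Finset.Ioi (1 : Fin 3) = {2} := by decide
  have h2 : Finset.Ioi (2 : Fin 3) = ∅ := by decide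
  simp [wedge, Fin.sum_univ_three, h0, h1, h2]

theorem wedge_smul (r s : ℝ) (x y : E3) : wedge (r • x) (s • y) = (r * s) • wedge x y := by
  simp only [wedge_eq, PiLp.smul_apply, smul_eq_mul]
  module

theorem homKernel_smul (k : ℕ) (r s : ℝ) (x y : E3) :
    homKernel k (r • x) (s • y) = (r * s) ^ k • homKernel k x y := by
  have h1 : 2 * inner ℝ (r • x) (s • y) = (r * s) * (2 * inner ℝ x y) := by
    rw [real_inner_smul_left, real_inner_smul_right]; ring
  have h2 : inner ℝ (r • x) (r • x) * inner ℝ (s • y) (s • y)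
      = (r * s) ^ 2 * (inner ℝ x x * inner ℝ y y) := by
    simp only [real_inner_smul_left, real_inner_smul_right]; ring
  rw [homKernel, homKernel, h1, h2, homGegenbauer_smul, homGegenbauer_smul, wedge_smul]
  rcases k with _ | k
  · simp
  · simp only [Algebra.algebraMap_eq_smul_one, Nat.add_sub_cancel, Nat.add_eq_zero_iff,
      one_ne_zero, and_false, if_false]
    module

theorem gramMatrix_closedFormKernel (k : ℕ) {n : ℕ} (η : Fin n → S2) :
    gramMatrix (closedFormKernel k) η = gramMatrix (homKernel k) η := by
  ext i j
  have h : ∀ i, inner ℝ (η i : E3) (η i : E3) = (1 : ℝ) := fun i => by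
    rw [real_inner_self_eq_norm_sq, norm_eq_of_mem_sphere, one_pow]
  simp only [gramMatrix, Matrix.of_apply, closedFormKernel, homKernel, h, mul_one,
    homGegenbauer_one]

theorem analyticOnNhd_homKernel (k : ℕ) (φ : Cl3 →ₗ[ℝ] ℝ) :
    AnalyticOnNhd ℝ (fun p : E3 × E3 => φ (homKernel k p.1 p.2)) Set.univ := by
  intro p _
  have hcoord : ∀ (q : E3 × E3 →L[ℝ] E3) (i : Fin 3), AnalyticAt ℝ (fun p => q p i) p :=
    fun q i => ((EuclideanSpace.proj (𝕜 := ℝ) i).comp q).analyticAt p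
  have h1 : ∀ i, AnalyticAt ℝ (fun p : E3 × E3 => p.1 i) p :=
    hcoord (ContinuousLinearMap.fst ℝ E3 E3)
  have h2 : ∀ i, AnalyticAt ℝ (fun p : E3 × E3 => p.2 i) p :=
    hcoord (ContinuousLinearMap.snd ℝ E3 E3)
  have hG : ∀ (μ : ℝ) (n : ℕ), AnalyticAt ℝ (fun p : E3 × E3 => homGegenbauer μ n
      (2 * inner ℝ p.1 p.2) (inner ℝ p.1 p.1 * inner ℝ p.2 p.2)) p := by
    intro μ n
    simp only [homGegenbauer, PiLp.inner_apply, Fin.sum_univ_three, RCLike.inner_apply, conj_trivial]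
    fun_prop
  have hφ : ∀ x y : E3, φ (homKernel k x y) = (k + 1) * homGegenbauer (1 / 2) k
      (2 * inner ℝ x y) (inner ℝ x x * inner ℝ y y) * φ 1
      + (if k = 0 then 0 else
        homGegenbauer (3 / 2) (k - 1) (2 * inner ℝ x y) (inner ℝ x x * inner ℝ y y))
        * ((x 0 * y 1 - x 1 * y 0) * φ (e 0 * e 1)
    + (x 0 * y 2 - x 2 * y 0) * φ (e 0 * e 2) + (x 1 * y 2 - x 2 * y 1) * φ (e 1 * e 2)) := by
    intro x y
    simp only [homKernel, wedge_eq, Algebra.algebraMap_eq_smul_one, map_add, map_smul, smul_eq_mul]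
  simp only [hφ]
  have hG1 := hG (1 / 2) k
  have hG2 := hG (3 / 2) (k - 1)
  split_ifs <;> fun_prop

/-- The complex numbers inside the Clifford algebra, with imaginary unit `e 1 * e 2`. -/
noncomputable def complexToCl3 : ℂ →ₐ[ℝ] Cl3 :=
  Complex.liftAux (e 1 * e 2) (by
    have h : e 1 * e 2 = -(e 2 * e 1) := e_anticomm (by decide)
    have h2 : e 1 * e 2 * (e 1 * e 2) = -(e 1 * (e 2 * e 2) * e 1) := by
      nth_rewrite 2 [h]
      simp only [mul_neg, mul_assoc]
    rw [h2, e_sq, mul_neg_one, neg_mul, e_sq, neg_neg])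

/-- The closed-form kernel on the plane of the last two coordinates. -/
theorem homKernel_linePoint {k n : ℕ} (i j : Fin n) : homKernel k (linePoint i) (linePoint j) =
    complexToCl3 (binaryForm (fun a b => (2 * a + 1) *
      (pochhammerCoeff (1 / 2) a * pochhammerCoeff (1 / 2) b))
      ((i - Complex.I) * (j + Complex.I)) ((i + Complex.I) * (j - Complex.I)) k) := by
  -- The real part of `w` is the inner product of the two points, its imaginary part is the
  -- coefficient of `e 1 * e 2` in their wedge, and `|w|²` is the product of their squared norms.
  set w : ℂ := ((i : ℂ) - Complex.I) * (j + Complex.I) with hw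
  have hre : w.re = i * j + 1 := by simp [hw]
  have him : w.im = i - j := by simp [hw]; ring
  have hconj : (starRingEnd ℂ) w = (i + Complex.I) * (j - Complex.I) := by
    rw [hw, map_mul, map_sub, map_add, Complex.conj_I, Complex.conj_natCast, Complex.conj_natCast]
    ring
  have hin : ∀ a b : Fin n, inner ℝ (linePoint a) (linePoint b) = (a * b + 1 : ℝ) := by
    intro a b
    simp [linePoint, PiLp.inner_apply, Fin.sum_univ_three, mul_comm]
  have hsq : Complex.normSq w = inner ℝ (linePoint i) (linePoint i)
      * inner ℝ (linePoint j) (linePoint j) := by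
    rw [Complex.normSq_apply, hre, him, hin, hin]; ring
  have hwedge : wedge (linePoint i) (linePoint j) = complexToCl3 (w.im * Complex.I) := by
    rw [wedge_eq]
    simp [linePoint, him, complexToCl3, Complex.liftAux_apply]
  have himI : (w.im : ℂ) * Complex.I = (w - (starRingEnd ℂ) w) / 2 := by
    rw [Complex.sub_conj]; push_cast; ring
  -- For `a + b = k` the weights add up to `(k + 1) + (a - b) = 2a + 1`, which is positive.
  have hsum : binaryForm (fun a b => (2 * a + 1) *
      (pochhammerCoeff (1 / 2) a * pochhammerCoeff (1 / 2) b)) w ((starRingEnd ℂ) w) k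
      = (k + 1) * binaryForm (fun a b => pochhammerCoeff (1 / 2) a * pochhammerCoeff (1 / 2) b)
          w ((starRingEnd ℂ) w) k
        + binaryForm (fun a b => ((a : ℝ) - b) * (pochhammerCoeff (1 / 2) a
          * pochhammerCoeff (1 / 2) b)) w ((starRingEnd ℂ) w) k := by
    simp only [binaryForm, Finset.mul_sum]
    rw [← Finset.sum_add_distrib]
    refine Finset.sum_congr rfl fun p hp => ?_
    have hk : (k : ℂ) = p.1 + p.2 := by
      exact_mod_cast (Finset.HasAntidiagonal.mem_antidiagonal.mp hp).symm
    rw [hk]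
    push_cast
    ring
  rw [homKernel, hwedge, ← hconj, hsum, ← hsq, hin, ← hre, map_add]
  congr 1
  · rw [← homGegenbauer_eq_binaryForm, ← AlgHom.commutes complexToCl3]
    congr 1
    push_cast
    simp
  · rcases k with _ | k
    · simp [binaryForm]
    · rw [← sub_conj_mul_homGegenbauer, ← himI, ← map_smul]
      congr 1
      simp [mul_comm]

/-- Here `w = z' i * z j` and `w̄ = z i * z' j`, so each term of the binary form splits into a
factor in `i`, a positive constant and a factor in `j`. The projective Vandermonde factors are
invertible because the points `(z' i : z i)` of the projective line are distinct. -/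
theorem isUnit_vectorGram_homKernel (k : ℕ) :
    IsUnit (vectorGram (homKernel k) (linePoint : Fin (k + 1) → E3)) := by
  let z : Fin (k + 1) → ℂ := fun i => i + Complex.I
  let z' : Fin (k + 1) → ℂ := fun i => i - Complex.I
  let c : Fin (k + 1) → ℂ := fun a => (((2 * (a : ℕ) + 1) *
      (pochhammerCoeff (1 / 2) a * pochhammerCoeff (1 / 2) (k - a)) : ℝ) : ℂ)
  have hsub : ∀ i j : Fin (k + 1), i ≠ j → (i : ℂ) - j ≠ 0 := by
    intro i j hij h
    exact hij (Fin.ext (Nat.cast_injective (sub_eq_zero.mp h)))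
  have hA : IsUnit (Matrix.projVandermonde z' z) := by
    rw [Matrix.isUnit_iff_isUnit_det, isUnit_iff_ne_zero, Matrix.det_projVandermonde]
    refine Finset.prod_ne_zero_iff.mpr fun i _ => Finset.prod_ne_zero_iff.mpr fun j hj => ?_
    have : z' j * z i - z' i * z j = 2 * Complex.I * (j - i) := by simp only [z, z']; ring
    rw [this]
    exact mul_ne_zero (by simp) (hsub j i (Finset.mem_Ioi.mp hj).ne')
  have hB : IsUnit (Matrix.projVandermonde z z').transpose := by
    rw [Matrix.isUnit_transpose, Matrix.isUnit_iff_isUnit_det, isUnit_iff_ne_zero,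
      Matrix.det_projVandermonde]
    refine Finset.prod_ne_zero_iff.mpr fun i _ => Finset.prod_ne_zero_iff.mpr fun j hj => ?_
    have : z j * z' i - z i * z' j = 2 * Complex.I * (i - j) := by simp only [z, z']; ring
    rw [this]
    exact mul_ne_zero (by simp) (hsub i j (Finset.mem_Ioi.mp hj).ne)
  have hD : IsUnit (Matrix.diagonal c) := by
    rw [Matrix.isUnit_diagonal, Pi.isUnit_iff]
    intro a
    refine isUnit_iff_ne_zero.mpr (Complex.ofReal_ne_zero.mpr (ne_of_gt ?_))
    have := pochhammerCoeff_pos (μ := 1 / 2) (by norm_num)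
    have := mul_pos (this a) (this (k - a))
    positivity
  have : vectorGram (homKernel k) (linePoint : Fin (k + 1) → E3) =
      (complexToCl3 : ℂ →+* Cl3).mapMatrix (Matrix.projVandermonde z' z * Matrix.diagonal c
        * (Matrix.projVandermonde z z').transpose) := by
    ext i j
    rw [vectorGram, Matrix.of_apply, homKernel_linePoint, RingHom.mapMatrix_apply,
      Matrix.map_apply, Matrix.mul_apply]
    simp only [Matrix.mul_diagonal, Matrix.transpose_apply, Matrix.projVandermonde_apply]
    refine congrArg complexToCl3 ?_
    rw [binaryForm, Finset.Nat.sum_antidiagonal_eq_sum_range_succ_mk, Finset.sum_range]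
    refine Finset.sum_congr rfl fun a _ => ?_
    have : (a.rev : ℕ) = k - a := by rw [Fin.val_rev]; omega
    rw [this, mul_pow, mul_pow]
    simp only [z, z', c]
    ring
  rw [this]
  exact ((hA.mul hD).mul hB).map _

/-- For almost every `(k+1)`-tuple of points of the sphere the Gram matrix of the reproducing kernel
of the spherical monogenics of order `k` is invertible, for the kernel built from any orthonormal
basis as well as for the kernel in closed form. -/
theorem mainTheorem4 (k : ℕ) :
    (∀ (d : ℕ) (Y : Fin d → CliffordPoly), IsMonogenicONB k Y →
      ∀ᵐ η ∂(Measure.pi fun _ : Fin (k + 1) => surfaceMeasure),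
        IsUnit (gramMatrix (monogenicKernel Y) η)) ∧
    (∀ᵐ η ∂(Measure.pi fun _ : Fin (k + 1) => surfaceMeasure),
      IsUnit (gramMatrix (closedFormKernel k) η)) := by
  refine ⟨fun d Y hY => ?_, ?_⟩
  · have hmem : ∀ l, Y l ∈ sphericalMonogenics k := fun l => by
      rw [← hY.span_eq]
      exact Submodule.subset_span ⟨l, rfl⟩
    exact ae_isUnit_gramMatrix (analyticOnNhd_monogenicKernel Y) (monogenicKernel_smul hmem)
      (isUnit_vectorGram_monogenicKernel hY.span_eq)
  · simp only [gramMatrix_closedFormKernel]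
    exact ae_isUnit_gramMatrix (analyticOnNhd_homKernel k) (homKernel_smul k)
      (isUnit_vectorGram_homKernel k)
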